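/- Let $k\ge 2$ and let $\mathcal H=\mathcal H_{A_1}\otimes\cdots\otimes\mathcal H_{A_k}$ be a tensor product of finite-dimensional complex Hilbert spaces with fixed orthonormal bases. A state is a positive semi-definite operator on $\mathcal H$ of unit trace. For a state $\rho$ and a positive semi-definite operator $\sigma$, let $$D(\rho\|\sigma)=\operatorname{Tr}[\rho(\log_2\rho-\log_2\sigma)]\ \text{ if } \operatorname{supp}\rho\subseteq\operatorname{supp}\sigma,\qquad D(\rho\|\sigma)=+\infty\ \text{ otherwise,}$$ and for $\alpha\in(0,1)\cup(1,\infty)$ let $$\widetilde D_\alpha(\rho\|\sigma)=\frac{1}{\alpha-1}\log_2\operatorname{Tr}\Big[\big(\sigma^{\frac{1-\alpha}{2\alpha}}\rho\,\sigma^{\frac{1-\alpha}{2\alpha}}\big)^{\alpha}\Big]$$ if $\alpha<1$ or $\operatorname{supp}\rho\subseteq\operatorname{supp}\sigma$, and $\widetilde D_\alpha(\rho\|\sigma)=+\infty$ otherwise; here logarithms and negative powers of operators are taken on the support, and $\log_2 0=-\infty$ for the number $0$ (so that $\widetilde D_\alpha(\rho\|\sigma)=+\infty$ if $\alpha<1$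 and the trace vanishes). For $\boldsymbol D\in\{D,\widetilde D_\alpha\}$ and a state $\rho$ on $\mathcal H$ put $$\boldsymbol R(\rho)=\inf\Big\{\boldsymbol D(\rho\|\sigma)+\log_2\Big(\sum_m r_m\|T_m(\omega_m)\|_1\Big)\ :\ \sigma=\sum_m r_m\omega_m\Big\},$$ where $m$ ranges over the unordered bipartitions of the $k$ parties into two nonempty groups, $(r_m)_m$ ranges over the probability distributions, each $\omega_m$ ranges over the states on $\mathcal H$, $T_m$ is the partial transpose with respect to one of the two groups of $m$ (the trace norm does not depend on which), and $\|X\|_1=\operatorname{Tr}\sqrt{X^\dagger X}$. For $\boldsymbol D=D$ this defines the genuine multipartite Rains entanglement (GMRE) $R(\rho)$, and for $\boldsymbol D=\widetilde D_\alpha$ the sandwiched Rényi–Rains entanglement $\widetilde R_\alpha(\rho)$. Then, for every state $\rho$ on $\mathcal H$, $$\lim_{\alpha\to1}\widetilde R_\alpha(\rho)=R(\rho),$$ the limit being two-sided. -/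

import Mathlib

noncomputable section

namespace MultipartiteRains

open scoped ComplexOrder

section Operators

variable {n : Type*} [Fintype n] [DecidableEq n]

/-- A quantum state: a positive semi-definite operator with unit trace. -/
def IsState (ρ : Matrix n n ℂ) : Prop :=
  ρ.PosSemidef ∧ ρ.trace = 1

/-- The support of an operator: the orthogonal complement of its kernel. -/
def supp (A : Matrix n n ℂ) : Submodule ℂ (EuclideanSpace ℂ n) :=
  (LinearMap.ker (Matrix.toEuclideanLin A))ᗮ

/-- The real power `A ^ p` of a positive semi-definite operator, through the spectral theorem.
Since `(0 : ℝ) ^ p = 0` for `p ≠ 0`, for `p < 0` the inverse is taken on the support. -/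
def opPow (A : Matrix n n ℂ) (p : ℝ) : Matrix n n ℂ :=
  cfc (fun x : ℝ => x ^ p) A

/-- The base-two logarithm of a positive semi-definite operator, taken on its support
(`Real.logb 2 0 = 0`). -/
def opLog (A : Matrix n n ℂ) : Matrix n n ℂ :=
  cfc (fun x : ℝ => Real.logb 2 x) A

/-- The trace norm `Tr |A|` with `|A| = √(Aᴴ A)`. -/
def traceNorm (A : Matrix n n ℂ) : ℝ :=
  (cfc Real.sqrt (A.conjTranspose * A)).trace.re

/-- The base-two logarithm of a nonnegative real, with `log₂ 0 = -∞`. -/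
def elog (x : ℝ) : EReal :=
  if x ≤ 0 then ⊥ else ((Real.logb 2 x : ℝ) : EReal)

open Classical in
/-- The quantum (Umegaki) relative entropy `D(ρ‖σ)`. -/
def relEntropy (ρ σ : Matrix n n ℂ) : EReal :=
  if supp ρ ≤ supp σ then (((ρ * (opLog ρ - opLog σ)).trace.re : ℝ) : EReal) else ⊤

/-- `Tr[(σ^((1-α)/(2α)) ρ σ^((1-α)/(2α)))^α]`. -/
def sandwichedQ (α : ℝ) (ρ σ : Matrix n n ℂ) : ℝ :=
  (opPow (opPow σ ((1 - α) / (2 * α)) * ρ * opPow σ ((1 - α) / (2 * α))) α).trace.re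

open Classical in
/-- The sandwiched Rényi relative entropy of order `α ∈ (0,1) ∪ (1,∞)`. For `α < 1` and `ρ`, `σ`
with orthogonal supports the trace vanishes and the value is `(α - 1)⁻¹ * (-∞) = +∞`. -/
def sandwichedRelEntropy (α : ℝ) (ρ σ : Matrix n n ℂ) : EReal :=
  if α < 1 ∨ (1 < α ∧ supp ρ ≤ supp σ) then
    ((1 / (α - 1) : ℝ) : EReal) * elog (sandwichedQ α ρ σ)
  else ⊤

end Operators

section Multipartite

variable {k : ℕ} {d : Fin k → ℕ}

/-- Operators on `ℂ^(d 0) ⊗ ⋯ ⊗ ℂ^(d (k-1))`, as matrices in the product basis. -/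
abbrev Op (d : Fin k → ℕ) : Type :=
  Matrix (∀ i, Fin (d i)) (∀ i, Fin (d i)) ℂ

/-- The unordered bipartitions `{S, Sᶜ}` of `k` parties into two nonempty groups, each represented
by the group `S` that does not contain the first party. -/
abbrev Bipartition (k : ℕ) : Type :=
  {S : Finset (Fin k) // S.Nonempty ∧ ∀ i ∈ S, (i : ℕ) ≠ 0}

/-- The partial transpose on the parties in `S`, in the product basis. -/
def partialTranspose (S : Finset (Fin k)) (X : Op d) : Op d :=
  Matrix.of fun a b =>
    X (fun i => if i ∈ S then b i else a i) (fun i => if i ∈ S then a i else b i)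

/-- The multipartite `D`-Rains entanglement: the infimum of
`D(ρ‖σ) + log₂ (∑ₘ rₘ ‖Tₘ(ωₘ)‖₁)` over all `σ = ∑ₘ rₘ ωₘ` with `r` a probability distribution on the
bipartitions and `ωₘ` states. -/
def rainsEntanglement (D : Op d → Op d → EReal) (ρ : Op d) : EReal :=
  sInf {x : EReal | ∃ (σ : Op d) (r : Bipartition k → ℝ) (ω : Bipartition k → Op d),
    IsState σ ∧ (∀ m, 0 ≤ r m) ∧ ∑ m, r m = 1 ∧ (∀ m, IsState (ω m)) ∧
    σ = ∑ m, (r m : ℂ) • ω m ∧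
    x = D ρ σ +
      ((Real.logb 2 (∑ m, r m * traceNorm (partialTranspose m.1 (ω m))) : ℝ) : EReal)}

/-- The genuine multipartite Rains entanglement (GMRE). -/
def gmre (ρ : Op d) : EReal :=
  rainsEntanglement relEntropy ρ

/-- The multipartite sandwiched Rényi–Rains entanglement of order `α`. -/
def sandwichedRains (α : ℝ) (ρ : Op d) : EReal :=
  rainsEntanglement (sandwichedRelEntropy α) ρ

end Multipartite

end MultipartiteRains

end

/-!
Both quantities are infima, over the same compact set of pairs `(r, ω)`, of functionals in which
only the divergence depends on `α`. Such infima converge as soon as the functionals satisfy an upper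
bound pointwise, `limsup D_α(ρ‖σ) ≤ D(ρ‖σ)`, and a lower bound `D(ρ‖σ) ≤ liminf D_α(ρ‖τ)` as
`(α, τ) → (1, σ)` jointly.

Because `ρ` has unit trace, comparing `D_α` with a number amounts to comparing its Tsallis analogue
`(Q_α - Tr ρ) / (α - 1)` with a quantity converging to that number, up to a factor `log 2`. The
Tsallis logarithm `(x ^ s - 1) / s` increases with `s`, and for `s > 0` it is continuous at `x = 0`,
where the logarithm is not. In the upper bound the Tsallis logarithm of `√ρ σ^((1-α)/α) √ρ` and in
the lower bound that of `σ` are therefore replaced by Tsallis logarithms of a fixed order `δ > 0`;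
then `α → 1`, and finally `δ → 0`. In the lower bound `ρ` and `σ` are first decoupled by Klein's
inequality for the convex function `x ^ α / (α - 1)`.
-/

noncomputable section

namespace MultipartiteRains

open scoped ComplexOrder
open Matrix Filter Topology

section TsallisLogarithm

/-- The Tsallis logarithm of order `s`, a deformation of the natural logarithm that is increasing
in `s`. Unlike `Real.log`, it is continuous also at `x = 0` when `0 < s`. At `s = 0` the value is
the junk value `0`, and at `x = 0` it is `-1 / s` also for `s < 0`. -/
def tsallisLog (s x : ℝ) : ℝ :=
  (x ^ s - 1) / s

lemma continuous_tsallisLog {s : ℝ} (hs : 0 ≤ s) : Continuous (tsallisLog s) :=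
  ((Real.continuous_rpow_const hs).sub continuous_const).div_const s

lemma tsallisLog_le_tsallisLog {x s t : ℝ} (hx : 0 < x) (hs : s ≠ 0) (ht : t ≠ 0) (hst : s ≤ t) :
    tsallisLog s x ≤ tsallisLog t x := by
  simpa [tsallisLog] using (convexOn_rpow_left hx).secant_mono (Set.mem_univ 0) (Set.mem_univ s)
    (Set.mem_univ t) hs ht hst

lemma tsallisLog_le_tsallisLog_of_pos {x s t : ℝ} (hx : 0 ≤ x) (hs : 0 < s) (hst : s ≤ t) :
    tsallisLog s x ≤ tsallisLog t x := by
  have ht := hs.trans_le hst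
  rcases hx.eq_or_lt with rfl | hx
  · simp only [tsallisLog, Real.zero_rpow hs.ne', Real.zero_rpow ht.ne', zero_sub, neg_div]
    gcongr
  · exact tsallisLog_le_tsallisLog hx hs.ne' ht.ne' hst

lemma tendsto_tsallisLog {x : ℝ} (hx : 0 < x) :
    Tendsto (tsallisLog · x) (𝓝[≠] 0) (𝓝 (Real.log x)) := by
  have hslope : slope (fun s : ℝ => x ^ s) 0 = (tsallisLog · x) := by
    funext s; simp [slope_def_field, tsallisLog]
  simpa [hslope, Function.comp_def] using
    hasDerivAt_iff_tendsto_slope.1 ((hasDerivAt_id (0 : ℝ)).const_rpow hx)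

lemma rpow_eq_one_add_mul_tsallisLog {s : ℝ} (hs : s ≠ 0) (x : ℝ) :
    x ^ s = 1 + s * tsallisLog s x := by
  rw [tsallisLog]; field_simp; ring

lemma rpow_eq_add_mul_tsallisLog {x α : ℝ} (hx : 0 ≤ x) (h0 : α ≠ 0) (h1 : α ≠ 1) :
    x ^ α = x + (α - 1) * (x * tsallisLog (α - 1) x) := by
  have hα : α = α - 1 + 1 := by ring
  calc x ^ α = x ^ (α - 1) * x := by
        rw [← Real.rpow_add_one' hx (by rwa [← hα]), ← hα]
    _ = _ := by rw [rpow_eq_one_add_mul_tsallisLog (sub_ne_zero.2 h1)]; ring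

lemma mul_sub_one_div_le_rpow_sub_one_div {z α : ℝ} (hz : 0 ≤ z) (h0 : 0 ≤ α) (h1 : α ≠ 1) :
    α * (z - 1) / (α - 1) ≤ (z ^ α - 1) / (α - 1) := by
  have hz' : -1 ≤ z - 1 := by linarith
  rcases h1.lt_or_gt with h1 | h1
  · have bernoulli := rpow_one_add_le_one_add_mul_self hz' h0 h1.le
    rw [add_sub_cancel] at bernoulli
    exact div_le_div_of_nonpos_of_le (by linarith) (by linarith)
  · have bernoulli := one_add_mul_self_le_rpow_one_add hz' h1.le
    rw [add_sub_cancel] at bernoulli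
    exact div_le_div_of_nonneg_right (by linarith) (by linarith)

lemma rpow_div_tangent_le {x y α : ℝ} (hx : 0 ≤ x) (hy : 0 ≤ y) (hxy : y = 0 → x = 0)
    (h0 : 0 ≤ α) (h1 : α ≠ 1) :
    (x - y) * (α * y ^ (α - 1) / (α - 1)) ≤ x ^ α / (α - 1) - y ^ α / (α - 1) := by
  rcases hy.eq_or_lt with rfl | hy
  · simp [hxy rfl]
  have hyα : y ^ α = y ^ (α - 1) * y := by rw [← Real.rpow_add_one hy.ne', sub_add_cancel]
  have hxα : x ^ α = (x / y) ^ α * y ^ α := by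
    rw [← Real.mul_rpow (div_nonneg hx hy.le) hy.le, div_mul_cancel₀ _ hy.ne']
  calc (x - y) * (α * y ^ (α - 1) / (α - 1)) = y ^ α * (α * (x / y - 1) / (α - 1)) := by
        rw [hyα]; field_simp
    _ ≤ y ^ α * (((x / y) ^ α - 1) / (α - 1)) :=
        mul_le_mul_of_nonneg_left
          (mul_sub_one_div_le_rpow_sub_one_div (div_nonneg hx hy.le) h0 h1) (by positivity)
    _ = _ := by rw [hxα]; ring

end TsallisLogarithm

section FunctionalCalculus

variable {n : Type*} [Fintype n]

lemma continuous_trace_re : Continuous fun A : Matrix n n ℂ => A.trace.re :=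
  Complex.continuous_re.comp continuous_id.matrix_trace

variable [DecidableEq n] {A : Matrix n n ℂ}

lemma continuousOn_spectrum (A : Matrix n n ℂ) (f : ℝ → ℝ) : ContinuousOn f (spectrum ℝ A) :=
  A.finite_real_spectrum.continuousOn f

lemma isHermitian_cfc (f : ℝ → ℝ) (A : Matrix n n ℂ) : (cfc f A).IsHermitian :=
  cfc_predicate f A

lemma cfc_mul_cfc (f g : ℝ → ℝ) (A : Matrix n n ℂ) :
    cfc f A * cfc g A = cfc (fun x => f x * g x) A :=
  (cfc_mul f g A (continuousOn_spectrum A f) (continuousOn_spectrum A g)).symm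

lemma mul_cfc (hA : A.IsHermitian) (g : ℝ → ℝ) : A * cfc g A = cfc (fun x => x * g x) A := by
  nth_rewrite 1 [← cfc_id' ℝ A hA.isSelfAdjoint]
  exact cfc_mul_cfc _ g A

lemma cfc_congr_of_posSemidef (hA : A.PosSemidef) {f g : ℝ → ℝ} (h : ∀ x, 0 ≤ x → f x = g x) :
    cfc f A = cfc g A := by
  refine cfc_congr fun x hx => h x ?_
  rw [hA.isHermitian.spectrum_real_eq_range_eigenvalues] at hx
  obtain ⟨i, rfl⟩ := hx
  exact hA.eigenvalues_nonneg i

lemma cfc_sqrt_mul_cfc_sqrt (hA : A.PosSemidef) : cfc Real.sqrt A * cfc Real.sqrt A = A := by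
  rw [cfc_mul_cfc, cfc_congr_of_posSemidef hA fun x hx => Real.mul_self_sqrt hx,
    cfc_id' ℝ A hA.isHermitian.isSelfAdjoint]

lemma cfc_eq_conj (hA : A.IsHermitian) (f : ℝ → ℝ) :
    cfc f A = (hA.eigenvectorUnitary : Matrix n n ℂ) *
      diagonal (fun i => (f (hA.eigenvalues i) : ℂ)) *
        (hA.eigenvectorUnitary : Matrix n n ℂ)ᴴ := by
  rw [hA.cfc_eq, Matrix.IsHermitian.cfc, Unitary.conjStarAlgAut_apply]
  rfl

lemma trace_cfc_re (hA : A.IsHermitian) (f : ℝ → ℝ) :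
    (cfc f A).trace.re = ∑ i, f (hA.eigenvalues i) := by
  rw [cfc_eq_conj hA, Matrix.trace_mul_cycle, ← Matrix.star_eq_conjTranspose,
    Unitary.coe_star_mul_self, Matrix.one_mul, Matrix.trace_diagonal, Complex.re_sum]
  rfl

lemma trace_re_eq_sum_eigenvalues (hA : A.IsHermitian) : A.trace.re = ∑ i, hA.eigenvalues i := by
  simp [hA.trace_eq_sum_eigenvalues]

lemma trace_cfc_conjTranspose_mul_self (A : Matrix n n ℂ) (f : ℝ → ℝ) :
    (cfc f (Aᴴ * A)).trace.re = (cfc f (A * Aᴴ)).trace.re := by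
  have h1 := isHermitian_conjTranspose_mul_self A
  have h2 := isHermitian_mul_conjTranspose_self A
  rw [trace_cfc_re h1, trace_cfc_re h2,
    (h1.eigenvalues_eq_eigenvalues_iff h2).2 (Matrix.charpoly_mul_comm _ _)]

lemma tendsto_cfc_of_eigenvalues {ι : Type*} {l : Filter ι} (hA : A.IsHermitian)
    {F : ι → ℝ → ℝ} {f : ℝ → ℝ}
    (h : ∀ j, Tendsto (fun i => F i (hA.eigenvalues j)) l (𝓝 (f (hA.eigenvalues j)))) :
    Tendsto (fun i => cfc (F i) A) l (𝓝 (cfc f A)) := by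
  simp only [cfc_eq_conj hA]
  have hdiag : Tendsto (fun i j => (F i (hA.eigenvalues j) : ℂ)) l
      (𝓝 fun j => (f (hA.eigenvalues j) : ℂ)) :=
    tendsto_pi_nhds.2 fun j => (Complex.continuous_ofReal.tendsto _).comp (h j)
  exact ((continuous_id.matrix_diagonal.tendsto _).comp hdiag).const_mul _ |>.mul_const _

open scoped Matrix.Norms.L2Operator in
lemma continuousOn_cfc_isHermitian {f : ℝ → ℝ} (hf : Continuous f) :
    ContinuousOn (fun A : Matrix n n ℂ => cfc f A) {A | A.IsHermitian} :=
  ContinuousOn.cfc_of_mem_nhdsSet (s := Set.univ) f (by simp) continuousOn_id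
    (fun _ hx => hx) hf.continuousOn

lemma tendsto_cfc {ι : Type*} {l : Filter ι} {f : ℝ → ℝ} (hf : Continuous f)
    {X : ι → Matrix n n ℂ} (hX : Tendsto X l (𝓝 A)) (hXh : ∀ᶠ i in l, (X i).IsHermitian)
    (hA : A.IsHermitian) : Tendsto (fun i => cfc f (X i)) l (𝓝 (cfc f A)) :=
  (continuousOn_cfc_isHermitian hf A hA).tendsto.comp (tendsto_nhdsWithin_iff.2 ⟨hX, hXh⟩)

end FunctionalCalculus

section KleinInequality

variable {n : Type*} [Fintype n] [DecidableEq n] {A B : Matrix n n ℂ}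

/-- The squared moduli of the inner products between the eigenvectors of two Hermitian matrices:
they reduce traces of products of functions of `A` and `B` to sums of scalars. -/
def overlap (hA : A.IsHermitian) (hB : B.IsHermitian) (i j : n) : ℝ :=
  ‖((hA.eigenvectorUnitary : Matrix n n ℂ)ᴴ * (hB.eigenvectorUnitary : Matrix n n ℂ)) i j‖ ^ 2

lemma overlap_nonneg (hA : A.IsHermitian) (hB : B.IsHermitian) (i j : n) :
    0 ≤ overlap hA hB i j :=
  sq_nonneg _

lemma conj_cfc_mul_cfc_apply (hA : A.IsHermitian) (hB : B.IsHermitian) (f g : ℝ → ℝ) (i j : n) :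
    ((hA.eigenvectorUnitary : Matrix n n ℂ)ᴴ * (cfc f A * cfc g B) *
        (hB.eigenvectorUnitary : Matrix n n ℂ)) i j =
      f (hA.eigenvalues i) * g (hB.eigenvalues j) *
        ((hA.eigenvectorUnitary : Matrix n n ℂ)ᴴ * (hB.eigenvectorUnitary : Matrix n n ℂ)) i j := by
  have hU : (hA.eigenvectorUnitary : Matrix n n ℂ)ᴴ * hA.eigenvectorUnitary = 1 :=
    Unitary.coe_star_mul_self _
  have hV : (hB.eigenvectorUnitary : Matrix n n ℂ)ᴴ * hB.eigenvectorUnitary = 1 :=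
    Unitary.coe_star_mul_self _
  rw [cfc_eq_conj hA, cfc_eq_conj hB]
  set U := (hA.eigenvectorUnitary : Matrix n n ℂ)
  set V := (hB.eigenvectorUnitary : Matrix n n ℂ)
  set D := diagonal fun i => (f (hA.eigenvalues i) : ℂ)
  set E := diagonal fun j => (g (hB.eigenvalues j) : ℂ)
  have hDE : Uᴴ * (U * D * Uᴴ * (V * E * Vᴴ)) * V = D * (Uᴴ * V) * E := by
    calc _ = (Uᴴ * U) * D * (Uᴴ * V) * E * (Vᴴ * V) := by simp only [Matrix.mul_assoc]
      _ = _ := by rw [hU, hV, Matrix.one_mul, Matrix.mul_one]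
  rw [hDE, Matrix.mul_diagonal, Matrix.diagonal_mul]
  ring

lemma trace_cfc_mul_cfc_re (hA : A.IsHermitian) (hB : B.IsHermitian) (f g : ℝ → ℝ) :
    (cfc f A * cfc g B).trace.re =
      ∑ i, ∑ j, overlap hA hB i j * (f (hA.eigenvalues i) * g (hB.eigenvalues j)) := by
  have hUU : (hA.eigenvectorUnitary : Matrix n n ℂ) * (hA.eigenvectorUnitary : Matrix n n ℂ)ᴴ = 1 :=
    Unitary.coe_mul_star_self _
  have hVV : (hB.eigenvectorUnitary : Matrix n n ℂ) * (hB.eigenvectorUnitary : Matrix n n ℂ)ᴴ = 1 :=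
    Unitary.coe_mul_star_self _
  have hM := conj_cfc_mul_cfc_apply hA hB f g
  simp only [overlap]
  set U := (hA.eigenvectorUnitary : Matrix n n ℂ)
  set V := (hB.eigenvectorUnitary : Matrix n n ℂ)
  have htrace : (cfc f A * cfc g B).trace =
      (Uᴴ * (cfc f A * cfc g B) * V * (Uᴴ * V)ᴴ).trace := by
    rw [conjTranspose_mul, conjTranspose_conjTranspose, Matrix.mul_assoc _ V, ← Matrix.mul_assoc V,
      hVV, Matrix.one_mul, Matrix.trace_mul_cycle, hUU, Matrix.one_mul]
  rw [htrace, Matrix.trace, Complex.re_sum]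
  refine Finset.sum_congr rfl fun i _ => ?_
  rw [Matrix.diag_apply, Matrix.mul_apply, Complex.re_sum]
  refine Finset.sum_congr rfl fun j _ => ?_
  rw [hM, Matrix.conjTranspose_apply, mul_assoc, RCLike.star_def, Complex.mul_conj,
    Complex.normSq_eq_norm_sq]
  norm_cast
  ring

lemma trace_cfc_re_eq_sum_left (hA : A.IsHermitian) (hB : B.IsHermitian) (f : ℝ → ℝ) :
    (cfc f A).trace.re = ∑ i, ∑ j, overlap hA hB i j * f (hA.eigenvalues i) := by
  simpa [cfc_const_one ℝ B hB.isSelfAdjoint] using trace_cfc_mul_cfc_re hA hB f fun _ => 1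

lemma trace_cfc_re_eq_sum_right (hA : A.IsHermitian) (hB : B.IsHermitian) (g : ℝ → ℝ) :
    (cfc g B).trace.re = ∑ i, ∑ j, overlap hA hB i j * g (hB.eigenvalues j) := by
  simpa [cfc_const_one ℝ A hA.isSelfAdjoint] using trace_cfc_mul_cfc_re hA hB (fun _ => 1) g

lemma trace_mul_cfc_re (hA : A.IsHermitian) (hB : B.IsHermitian) (g : ℝ → ℝ) :
    (A * cfc g B).trace.re =
      ∑ i, ∑ j, overlap hA hB i j * (hA.eigenvalues i * g (hB.eigenvalues j)) := by
  nth_rewrite 1 [← cfc_id' ℝ A hA.isSelfAdjoint]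
  exact trace_cfc_mul_cfc_re hA hB _ g

lemma trace_cfc_mul_cfc_re_le (hA : A.IsHermitian) (hB : B.IsHermitian) {f g f' g' : ℝ → ℝ}
    (h : ∀ i j, overlap hA hB i j ≠ 0 → f (hA.eigenvalues i) * g (hB.eigenvalues j) ≤
      f' (hA.eigenvalues i) * g' (hB.eigenvalues j)) :
    (cfc f A * cfc g B).trace.re ≤ (cfc f' A * cfc g' B).trace.re := by
  simp only [trace_cfc_mul_cfc_re hA hB]
  gcongr ∑ i, ∑ j, ?_ with i _ j _
  by_cases hij : overlap hA hB i j = 0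
  · simp [hij]
  · exact mul_le_mul_of_nonneg_left (h i j hij) (overlap_nonneg hA hB i j)

theorem klein_inequality (hA : A.IsHermitian) (hB : B.IsHermitian) {f g : ℝ → ℝ}
    (h : ∀ i j, overlap hA hB i j ≠ 0 →
      (hA.eigenvalues i - hB.eigenvalues j) * g (hB.eigenvalues j) ≤
        f (hA.eigenvalues i) - f (hB.eigenvalues j)) :
    ((A - B) * cfc g B).trace.re ≤ (cfc f A).trace.re - (cfc f B).trace.re := by
  rw [Matrix.sub_mul, Matrix.trace_sub, Complex.sub_re, mul_cfc hB, trace_mul_cfc_re hA hB,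
    trace_cfc_re_eq_sum_right hA hB, trace_cfc_re_eq_sum_left hA hB f,
    trace_cfc_re_eq_sum_right hA hB f]
  simp only [← Finset.sum_sub_distrib, ← mul_sub]
  gcongr ∑ i, ∑ j, ?_ with i _ j _
  by_cases hij : overlap hA hB i j = 0
  · simp [hij]
  · rw [← sub_mul]
    exact mul_le_mul_of_nonneg_left (h i j hij) (overlap_nonneg hA hB i j)

end KleinInequality

section Support

variable {n : Type*} [Fintype n] [DecidableEq n] {A B : Matrix n n ℂ}

/-- The orthogonal projection onto the kernel of a Hermitian matrix. -/
def kerProj (A : Matrix n n ℂ) : Matrix n n ℂ :=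
  cfc (fun x : ℝ => if x = 0 then 1 else 0) A

lemma isHermitian_kerProj (A : Matrix n n ℂ) : (kerProj A).IsHermitian :=
  isHermitian_cfc _ A

lemma kerProj_mul_self (A : Matrix n n ℂ) : kerProj A * kerProj A = kerProj A := by
  rw [kerProj, cfc_mul_cfc]
  congr 1; funext x
  split_ifs <;> simp

lemma mul_kerProj (hA : A.IsHermitian) : A * kerProj A = 0 := by
  rw [kerProj, mul_cfc hA, ← cfc_const_zero ℝ A]
  congr 1; funext x
  split_ifs with hx <;> simp [hx]

lemma kerProj_mulVec (hA : A.IsHermitian) {v : n → ℂ} (hv : A *ᵥ v = 0) :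
    kerProj A *ᵥ v = v := by
  have hsum : kerProj A + cfc (fun x : ℝ => x⁻¹) A * A = 1 := by
    nth_rewrite 3 [← cfc_id' ℝ A hA.isSelfAdjoint]
    rw [kerProj, cfc_mul_cfc, ← cfc_add (a := A) (hf := continuousOn_spectrum _ _)
      (hg := continuousOn_spectrum _ _), ← cfc_const_one ℝ A hA.isSelfAdjoint]
    congr 1; funext x
    by_cases hx : x = 0 <;> simp [hx]
  simpa [Matrix.add_mulVec, ← Matrix.mulVec_mulVec, hv] using congrArg (· *ᵥ v) hsum

lemma supp_le_supp_iff_mulVec : supp A ≤ supp B ↔ ∀ v : n → ℂ, B *ᵥ v = 0 → A *ᵥ v = 0 := by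
  have mem_ker (C : Matrix n n ℂ) (v : EuclideanSpace ℂ n) :
      v ∈ LinearMap.ker (Matrix.toEuclideanLin C) ↔ C *ᵥ WithLp.ofLp v = 0 := by
    rw [LinearMap.mem_ker, ← (WithLp.ofLp_injective 2).eq_iff]
    rfl
  rw [supp, supp, Submodule.orthogonal_le_orthogonal_iff]
  exact ⟨fun h v hv => (mem_ker A (WithLp.toLp 2 v)).1 (h ((mem_ker B _).2 hv)),
    fun h v hv => (mem_ker A v).2 (h _ ((mem_ker B v).1 hv))⟩

lemma supp_le_supp_iff_mul_kerProj (hB : B.IsHermitian) :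
    supp A ≤ supp B ↔ A * kerProj B = 0 := by
  rw [supp_le_supp_iff_mulVec]
  refine ⟨fun h => Matrix.ext_of_mulVec_single fun i => ?_, fun h v hv => ?_⟩
  · rw [← Matrix.mulVec_mulVec, Matrix.zero_mulVec]
    refine h _ ?_
    rw [Matrix.mulVec_mulVec, mul_kerProj hB, Matrix.zero_mulVec]
  · rw [← kerProj_mulVec hB hv, Matrix.mulVec_mulVec, h, Matrix.zero_mulVec]

lemma supp_mul_le (A B : Matrix n n ℂ) : supp (A * B) ≤ supp B :=
  supp_le_supp_iff_mulVec.2 fun v hv => by rw [← Matrix.mulVec_mulVec, hv, Matrix.mulVec_zero]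

lemma supp_cfc_le (hA : A.IsHermitian) {f : ℝ → ℝ} (hf : f 0 = 0) : supp (cfc f A) ≤ supp A := by
  have hfactor : cfc f A = cfc (fun x => f x / x) A * A := by
    nth_rewrite 3 [← cfc_id' ℝ A hA.isSelfAdjoint]
    rw [cfc_mul_cfc]
    congr 1; funext x
    by_cases hx : x = 0 <;> simp [hx, hf]
  rw [hfactor]
  exact supp_mul_le _ A

lemma eigenvalues_eq_zero_of_supp_le (hA : A.IsHermitian) (hB : B.IsHermitian)
    (h : supp A ≤ supp B) {i j : n} (hij : overlap hA hB i j ≠ 0) (hj : hB.eigenvalues j = 0) :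
    hA.eigenvalues i = 0 := by
  have hzero := conj_cfc_mul_cfc_apply hA hB (fun x => x) (fun x => if x = 0 then 1 else 0) i j
  have hker := (supp_le_supp_iff_mul_kerProj hB).1 h
  rw [kerProj] at hker
  rw [cfc_id' ℝ A hA.isSelfAdjoint, hker] at hzero
  simpa [hj, norm_ne_zero_iff.1 (ne_zero_pow two_ne_zero hij)] using hzero

lemma trace_mul_kerProj_re_pos (hA : A.PosSemidef) (hB : B.IsHermitian) (h : ¬ supp A ≤ supp B) :
    0 < (A * kerProj B).trace.re := by
  set S := cfc Real.sqrt A * kerProj B with hS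
  have hAS : cfc Real.sqrt A * S = A * kerProj B := by
    rw [hS, ← Matrix.mul_assoc, cfc_sqrt_mul_cfc_sqrt hA]
  have htrace : (A * kerProj B).trace = (Sᴴ * S).trace := by
    rw [← kerProj_mul_self B, ← Matrix.mul_assoc, Matrix.trace_mul_comm, ← hAS, hS,
      Matrix.conjTranspose_mul, (isHermitian_cfc _ A).eq, (isHermitian_kerProj B).eq,
      Matrix.mul_assoc]
  have hne : (Sᴴ * S).trace ≠ 0 := fun hzero => h <| (supp_le_supp_iff_mul_kerProj hB).2 <| by
    rw [← hAS, Matrix.trace_conjTranspose_mul_self_eq_zero_iff.1 hzero, Matrix.mul_zero]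
  rw [htrace]
  exact (Complex.pos_iff.1
    ((posSemidef_conjTranspose_mul_self S).trace_nonneg.lt_of_ne hne.symm)).1

end Support

section RelativeEntropy

variable {n : Type*} [Fintype n] [DecidableEq n] {ρ σ : Matrix n n ℂ}

lemma cfc_tsallisLog_add_smul_kerProj (s : ℝ) (σ : Matrix n n ℂ) :
    cfc (tsallisLog s) σ + s⁻¹ • kerProj σ =
      cfc (fun x => tsallisLog s x + s⁻¹ * if x = 0 then 1 else 0) σ := by
  rw [kerProj, ← cfc_const_mul s⁻¹ _ σ (continuousOn_spectrum σ _),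
    ← cfc_add (a := σ) (hf := continuousOn_spectrum _ _) (hg := continuousOn_spectrum _ _)]

lemma tendsto_cfc_tsallisLog_add_smul_kerProj (hσ : σ.PosSemidef) :
    Tendsto (fun s : ℝ => cfc (tsallisLog s) σ + s⁻¹ • kerProj σ) (𝓝[≠] 0)
      (𝓝 (cfc Real.log σ)) := by
  -- The projection cancels the pole `-1 / s` of `tsallisLog s` at the eigenvalue `0`.
  simp only [cfc_tsallisLog_add_smul_kerProj]
  refine tendsto_cfc_of_eigenvalues hσ.isHermitian fun j => ?_
  rcases (hσ.eigenvalues_nonneg j).eq_or_lt with hj | hj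
  · rw [← hj, Real.log_zero]
    refine tendsto_const_nhds.congr' ?_
    filter_upwards [self_mem_nhdsWithin] with s hs
    simp only [tsallisLog, Real.zero_rpow hs, if_true]
    ring
  · simpa [hj.ne'] using tendsto_tsallisLog hj

lemma tendsto_mul_cfc_tsallisLog (hσ : σ.PosSemidef) (h : supp ρ ≤ supp σ) :
    Tendsto (fun s => ρ * cfc (tsallisLog s) σ) (𝓝[≠] 0) (𝓝 (ρ * cfc Real.log σ)) := by
  have hker := (supp_le_supp_iff_mul_kerProj hσ.isHermitian).1 h
  simpa [Matrix.mul_add, hker] using (tendsto_cfc_tsallisLog_add_smul_kerProj hσ).const_mul ρ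

/-- `Tr[ρ (f(ρ) - g(σ))]`. For `f = g = log` this is the Umegaki relative entropy in natural units,
provided that `supp ρ ≤ supp σ`; replacing one of the logarithms by a Tsallis logarithm gives its
upper and lower approximations. -/
def relEntropyWith (f g : ℝ → ℝ) (ρ σ : Matrix n n ℂ) : ℝ :=
  (ρ * (cfc f ρ - cfc g σ)).trace.re

lemma opLog_eq (A : Matrix n n ℂ) : opLog A = (Real.log 2)⁻¹ • cfc Real.log A := by
  rw [opLog, ← cfc_const_mul _ _ A (continuousOn_spectrum A _)]
  congr 1; funext x
  rw [Real.logb, div_eq_inv_mul]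

lemma relEntropy_eq (h : supp ρ ≤ supp σ) :
    relEntropy ρ σ = ((relEntropyWith Real.log Real.log ρ σ / Real.log 2 : ℝ) : EReal) := by
  rw [relEntropy, if_pos h, opLog_eq, opLog_eq, ← smul_sub, Matrix.mul_smul, Matrix.trace_smul,
    Complex.smul_re, smul_eq_mul, inv_mul_eq_div, relEntropyWith]

lemma tendsto_relEntropyWith_tsallisLog_left (hρ : ρ.PosSemidef) (σ : Matrix n n ℂ)
    (g : ℝ → ℝ) :
    Tendsto (fun s => relEntropyWith (tsallisLog s) g ρ σ) (𝓝[≠] 0)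
      (𝓝 (relEntropyWith Real.log g ρ σ)) := by
  simp only [relEntropyWith, Matrix.mul_sub]
  exact (continuous_trace_re.tendsto _).comp
    ((tendsto_mul_cfc_tsallisLog hρ le_rfl).sub_const _)

lemma tendsto_relEntropyWith_tsallisLog_right (hσ : σ.PosSemidef) (h : supp ρ ≤ supp σ)
    (f : ℝ → ℝ) :
    Tendsto (fun s => relEntropyWith f (tsallisLog s) ρ σ) (𝓝[≠] 0)
      (𝓝 (relEntropyWith f Real.log ρ σ)) := by
  simp only [relEntropyWith, Matrix.mul_sub]
  exact (continuous_trace_re.tendsto _).comp ((tendsto_mul_cfc_tsallisLog hσ h).const_sub _)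

lemma tendsto_relEntropyWith_tsallisLog_right_atTop (hρ : ρ.PosSemidef) (hσ : σ.PosSemidef)
    (h : ¬ supp ρ ≤ supp σ) (f : ℝ → ℝ) :
    Tendsto (fun s => relEntropyWith f (tsallisLog s) ρ σ) (𝓝[>] 0) atTop := by
  have hfinite := (continuous_trace_re.tendsto _).comp
    (((tendsto_cfc_tsallisLog_add_smul_kerProj hσ).const_sub (cfc f ρ)).const_mul ρ)
  have hpole : Tendsto (fun s : ℝ => s⁻¹ * (ρ * kerProj σ).trace.re) (𝓝[>] 0) atTop :=
    tendsto_inv_nhdsGT_zero.atTop_mul_const (trace_mul_kerProj_re_pos hρ hσ.isHermitian h)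
  refine ((hfinite.mono_left (nhdsGT_le_nhdsNE 0)).add_atTop hpole).congr fun s => ?_
  simp only [relEntropyWith, Function.comp_apply, Matrix.mul_sub, Matrix.mul_add, Matrix.mul_smul,
    Matrix.trace_sub, Matrix.trace_add, Matrix.trace_smul, Complex.sub_re, Complex.add_re,
    Complex.smul_re, smul_eq_mul]
  ring

lemma exists_relEntropyWith_tsallisLog_left_lt (hρ : ρ.PosSemidef) (h : supp ρ ≤ supp σ) {b : ℝ}
    (hb : relEntropy ρ σ < b) :
    ∃ δ > 0, relEntropyWith (tsallisLog δ) Real.log ρ σ < b * Real.log 2 := by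
  rw [relEntropy_eq h, EReal.coe_lt_coe_iff, div_lt_iff₀ (Real.log_pos one_lt_two)] at hb
  have hlim := (tendsto_relEntropyWith_tsallisLog_left hρ σ Real.log).mono_left
    (nhdsGT_le_nhdsNE 0)
  obtain ⟨δ, hlt, hδ⟩ := ((hlim.eventually_lt_const hb).and self_mem_nhdsWithin).exists
  exact ⟨δ, hδ, hlt⟩

lemma exists_lt_relEntropyWith_tsallisLog_right (hρ : ρ.PosSemidef) (hσ : σ.PosSemidef) {b : ℝ}
    (hb : b < relEntropy ρ σ) :
    ∃ δ > 0, b * Real.log 2 < relEntropyWith Real.log (tsallisLog δ) ρ σ := by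
  have hevent : ∀ᶠ δ in 𝓝[>] 0, b * Real.log 2 < relEntropyWith Real.log (tsallisLog δ) ρ σ := by
    by_cases h : supp ρ ≤ supp σ
    · rw [relEntropy_eq h, EReal.coe_lt_coe_iff, lt_div_iff₀ (Real.log_pos one_lt_two)] at hb
      exact ((tendsto_relEntropyWith_tsallisLog_right hσ h _).mono_left
        (nhdsGT_le_nhdsNE 0)).eventually_const_lt hb
    · exact (tendsto_relEntropyWith_tsallisLog_right_atTop hρ hσ h _).eventually_gt_atTop _
  obtain ⟨δ, hlt, hδ⟩ := (hevent.and self_mem_nhdsWithin).exists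
  exact ⟨δ, hδ, hlt⟩

end RelativeEntropy

section PuncturedNeighborhoodOfOne

lemma tendsto_sub_one_nhdsNE : Tendsto (fun α : ℝ => α - 1) (𝓝[≠] 1) (𝓝[≠] 0) := by
  refine tendsto_nhdsWithin_iff.2 ⟨?_, ?_⟩
  · exact ((continuous_sub_right (1 : ℝ)).tendsto' 1 0 (sub_self 1)).mono_left nhdsWithin_le_nhds
  · filter_upwards [self_mem_nhdsWithin] with α hα using sub_ne_zero.2 hα

lemma eventually_pos_and_ne_one : ∀ᶠ α : ℝ in 𝓝[≠] 1, 0 < α ∧ α ≠ 1 :=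
  (eventually_nhdsWithin_of_eventually_nhds (lt_mem_nhds one_pos)).and self_mem_nhdsWithin

lemma tendsto_one_sub_div_nhdsNE : Tendsto (fun α : ℝ => (1 - α) / α) (𝓝[≠] 1) (𝓝[≠] 0) := by
  refine tendsto_nhdsWithin_iff.2 ⟨?_, ?_⟩
  · have h : ContinuousAt (fun α : ℝ => (1 - α) / α) 1 := by fun_prop (disch := norm_num)
    simpa using h.tendsto.mono_left nhdsWithin_le_nhds
  · filter_upwards [eventually_pos_and_ne_one] with α hα
    exact div_ne_zero (sub_ne_zero.2 hα.2.symm) hα.1.ne'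

end PuncturedNeighborhoodOfOne

section SandwichedTsallis

variable {n : Type*} [Fintype n] [DecidableEq n] {ρ σ : Matrix n n ℂ} {α : ℝ}

lemma cfc_const_mul_rpow (c p : ℝ) (A : Matrix n n ℂ) :
    cfc (fun x => c * x ^ p) A = c • opPow A p :=
  cfc_const_mul c _ A (continuousOn_spectrum A _)

lemma opPow_eq_one_add (hσ : σ.IsHermitian) {s : ℝ} (hs : s ≠ 0) :
    opPow σ s = 1 + s • cfc (tsallisLog s) σ := by
  rw [opPow, funext (rpow_eq_one_add_mul_tsallisLog hs),
    cfc_const_add _ _ σ (continuousOn_spectrum σ _) hσ.isSelfAdjoint,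
    cfc_const_mul s _ σ (continuousOn_spectrum σ _), map_one]

lemma opPow_eq_add_smul (hρ : ρ.PosSemidef) (h0 : α ≠ 0) (h1 : α ≠ 1) :
    opPow ρ α = ρ + (α - 1) • (ρ * cfc (tsallisLog (α - 1)) ρ) := by
  rw [opPow, cfc_congr_of_posSemidef hρ fun x hx => rpow_eq_add_mul_tsallisLog hx h0 h1,
    cfc_add (a := ρ) (hf := continuousOn_spectrum _ _) (hg := continuousOn_spectrum _ _),
    cfc_const_mul _ _ ρ (continuousOn_spectrum ρ _), mul_cfc hρ.isHermitian,
    cfc_id' ℝ ρ hρ.isHermitian.isSelfAdjoint]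

lemma mul_opPow_sub_one (hρ : ρ.PosSemidef) (h0 : α ≠ 0) : ρ * opPow ρ (α - 1) = opPow ρ α := by
  rw [opPow, mul_cfc hρ.isHermitian]
  refine cfc_congr_of_posSemidef hρ fun x hx => ?_
  rw [mul_comm, ← Real.rpow_add_one' hx (by rwa [sub_add_cancel]), sub_add_cancel]

lemma opPow_mul_opPow_self (hσ : σ.PosSemidef) (p : ℝ) :
    opPow σ p * opPow σ p = opPow σ (2 * p) := by
  rw [opPow, cfc_mul_cfc]
  exact cfc_congr_of_posSemidef hσ fun x hx => by
    rw [← sq, ← Real.rpow_mul_natCast hx, mul_comm, Nat.cast_ofNat]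

/-- The operator `√ρ σ^((1-α)/α) √ρ`. It has the same eigenvalues as the operator inside
`sandwichedQ α ρ σ`, and its support is contained in that of `ρ`. -/
def sandwich (α : ℝ) (ρ σ : Matrix n n ℂ) : Matrix n n ℂ :=
  cfc Real.sqrt ρ * opPow σ ((1 - α) / α) * cfc Real.sqrt ρ

/-- The sandwiched Tsallis relative entropy of order `α`. For unit trace, the sandwiched Rényi
relative entropy is an increasing function of it. -/
def sandwichedTsallis (α : ℝ) (ρ σ : Matrix n n ℂ) : ℝ :=
  (sandwichedQ α ρ σ - ρ.trace.re) / (α - 1)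

lemma sandwich_eq_conjTranspose_mul_self (α : ℝ) (ρ : Matrix n n ℂ) (hσ : σ.PosSemidef) :
    sandwich α ρ σ = (opPow σ ((1 - α) / (2 * α)) * cfc Real.sqrt ρ)ᴴ *
      (opPow σ ((1 - α) / (2 * α)) * cfc Real.sqrt ρ) := by
  have hexp : (1 - α) / α = 2 * ((1 - α) / (2 * α)) := by
    rw [← mul_div_assoc, mul_div_mul_left _ _ two_ne_zero]
  rw [sandwich, hexp, ← opPow_mul_opPow_self hσ, Matrix.conjTranspose_mul, opPow,
    (isHermitian_cfc _ σ).eq, (isHermitian_cfc _ ρ).eq]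
  simp only [Matrix.mul_assoc]

lemma posSemidef_sandwich (α : ℝ) (ρ : Matrix n n ℂ) (hσ : σ.PosSemidef) :
    (sandwich α ρ σ).PosSemidef := by
  rw [sandwich_eq_conjTranspose_mul_self α ρ hσ]
  exact posSemidef_conjTranspose_mul_self _

lemma sandwichedQ_eq (α : ℝ) (hρ : ρ.PosSemidef) (hσ : σ.PosSemidef) :
    sandwichedQ α ρ σ = (opPow (sandwich α ρ σ) α).trace.re := by
  set S := opPow σ ((1 - α) / (2 * α)) with hS
  have hoperand : S * cfc Real.sqrt ρ * (S * cfc Real.sqrt ρ)ᴴ = S * ρ * S := by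
    nth_rewrite 3 [← cfc_sqrt_mul_cfc_sqrt hρ]
    rw [Matrix.conjTranspose_mul, (isHermitian_cfc _ ρ).eq, hS, opPow, (isHermitian_cfc _ σ).eq]
    simp only [Matrix.mul_assoc]
  rw [sandwich_eq_conjTranspose_mul_self α ρ hσ, opPow, trace_cfc_conjTranspose_mul_self,
    ← hS, hoperand, sandwichedQ, ← hS, opPow]

lemma supp_sandwich_le (α : ℝ) (hρ : ρ.IsHermitian) (σ : Matrix n n ℂ) :
    supp (sandwich α ρ σ) ≤ supp ρ :=
  (supp_mul_le _ _).trans (supp_cfc_le hρ Real.sqrt_zero)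

lemma trace_sandwich (α : ℝ) (hρ : ρ.PosSemidef) (σ : Matrix n n ℂ) :
    (sandwich α ρ σ).trace = (ρ * opPow σ ((1 - α) / α)).trace := by
  rw [sandwich, Matrix.trace_mul_cycle, cfc_sqrt_mul_cfc_sqrt hρ]

lemma trace_sandwich_mul_opPow (hρ : ρ.PosSemidef) (σ : Matrix n n ℂ) (h0 : α ≠ 0) :
    (sandwich α ρ σ * opPow ρ (α - 1)).trace = (opPow ρ α * opPow σ ((1 - α) / α)).trace := by
  have hpow : cfc Real.sqrt ρ * opPow ρ (α - 1) * cfc Real.sqrt ρ = opPow ρ α := by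
    rw [Matrix.mul_assoc, ← mul_opPow_sub_one hρ h0, opPow, (cfc_commute_cfc _ Real.sqrt ρ).eq,
      ← Matrix.mul_assoc, cfc_sqrt_mul_cfc_sqrt hρ]
  rw [sandwich, Matrix.mul_assoc, Matrix.trace_mul_cycle, hpow]

lemma tendsto_opPow_one (hρ : ρ.PosSemidef) : Tendsto (opPow ρ) (𝓝[≠] 1) (𝓝 ρ) := by
  have hlim := (tendsto_nhds_of_tendsto_nhdsWithin tendsto_sub_one_nhdsNE).smul
    ((tendsto_mul_cfc_tsallisLog hρ le_rfl).comp tendsto_sub_one_nhdsNE)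
  have hlim' := hlim.const_add ρ
  rw [zero_smul, add_zero] at hlim'
  refine hlim'.congr' ?_
  filter_upwards [eventually_pos_and_ne_one] with α hα
  exact (opPow_eq_add_smul hρ hα.1.ne' hα.2).symm

lemma tendsto_sandwich (hρ : ρ.PosSemidef) (hσ : σ.PosSemidef) (h : supp ρ ≤ supp σ) :
    Tendsto (fun α => sandwich α ρ σ) (𝓝[≠] 1) (𝓝 ρ) := by
  have hsqrt : supp (cfc Real.sqrt ρ) ≤ supp σ :=
    (supp_cfc_le hρ.isHermitian Real.sqrt_zero).trans h
  have hlim := (tendsto_nhds_of_tendsto_nhdsWithin tendsto_one_sub_div_nhdsNE).smul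
    ((tendsto_mul_cfc_tsallisLog hσ hsqrt).comp tendsto_one_sub_div_nhdsNE)
  have hlim' := (hlim.const_add (cfc Real.sqrt ρ)).mul_const (cfc Real.sqrt ρ)
  rw [zero_smul, add_zero, cfc_sqrt_mul_cfc_sqrt hρ] at hlim'
  refine hlim'.congr' ?_
  filter_upwards [tendsto_one_sub_div_nhdsNE self_mem_nhdsWithin] with α hα
  rw [sandwich, opPow_eq_one_add hσ.isHermitian hα, Matrix.mul_add, Matrix.mul_one,
    Matrix.mul_smul, Function.comp_apply]

end SandwichedTsallis

section SandwichedTsallisBounds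

variable {n : Type*} [Fintype n] [DecidableEq n] {ρ σ : Matrix n n ℂ} {α δ : ℝ}

lemma trace_opPow_sub_trace_div (hρ : ρ.PosSemidef) (h0 : α ≠ 0) (h1 : α ≠ 1) :
    ((opPow ρ α).trace.re - ρ.trace.re) / (α - 1) =
      (ρ * cfc (tsallisLog (α - 1)) ρ).trace.re := by
  rw [opPow_eq_add_smul hρ h0 h1, Matrix.trace_add, Complex.add_re, add_sub_cancel_left,
    Matrix.trace_smul, Complex.smul_re, smul_eq_mul, mul_div_cancel_left₀ _ (sub_ne_zero.2 h1)]

lemma trace_mul_opPow_sub_trace_div (ρ : Matrix n n ℂ) (hσ : σ.IsHermitian) (h0 : α ≠ 0)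
    (h1 : α ≠ 1) :
    ((ρ * opPow σ ((1 - α) / α)).trace.re - ρ.trace.re) / (α - 1) =
      -(α⁻¹ * (ρ * cfc (tsallisLog ((1 - α) / α)) σ).trace.re) := by
  have h1' : α - 1 ≠ 0 := sub_ne_zero.2 h1
  rw [opPow_eq_one_add hσ (div_ne_zero (sub_ne_zero.2 h1.symm) h0), Matrix.mul_add, Matrix.mul_one,
    Matrix.mul_smul, Matrix.trace_add, Complex.add_re, add_sub_cancel_left, Matrix.trace_smul,
    Complex.smul_re, smul_eq_mul]
  field_simp
  ring

lemma trace_mul_cfc_tsallisLog_re_le (hρ : ρ.PosSemidef) {s : ℝ} (hs : s ≠ 0) (hδ : δ ≠ 0)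
    (hsδ : s ≤ δ) :
    (ρ * cfc (tsallisLog s) ρ).trace.re ≤ (ρ * cfc (tsallisLog δ) ρ).trace.re := by
  simp only [mul_cfc hρ.isHermitian, trace_cfc_re hρ.isHermitian]
  refine Finset.sum_le_sum fun i _ => ?_
  rcases (hρ.eigenvalues_nonneg i).eq_or_lt with hi | hi
  · simp [← hi]
  · exact mul_le_mul_of_nonneg_left (tsallisLog_le_tsallisLog hi hs hδ hsδ) hi.le

lemma sandwichedTsallis_le (hρ : ρ.PosSemidef) (hσ : σ.PosSemidef) (h0 : α ≠ 0) (h1 : α ≠ 1)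
    (hδ : δ ≠ 0) (hαδ : α - 1 ≤ δ) :
    sandwichedTsallis α ρ σ ≤
      (sandwich α ρ σ * cfc (tsallisLog δ) (sandwich α ρ σ)).trace.re -
        α⁻¹ * (ρ * cfc (tsallisLog ((1 - α) / α)) σ).trace.re := by
  have hX := posSemidef_sandwich α ρ hσ
  calc sandwichedTsallis α ρ σ
      = ((opPow (sandwich α ρ σ) α).trace.re - (sandwich α ρ σ).trace.re) / (α - 1) +
          ((sandwich α ρ σ).trace.re - ρ.trace.re) / (α - 1) := by
        rw [sandwichedTsallis, sandwichedQ_eq α hρ hσ]; ring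
    _ = (sandwich α ρ σ * cfc (tsallisLog (α - 1)) (sandwich α ρ σ)).trace.re -
          α⁻¹ * (ρ * cfc (tsallisLog ((1 - α) / α)) σ).trace.re := by
        rw [trace_opPow_sub_trace_div hX h0 h1, trace_sandwich α hρ,
          trace_mul_opPow_sub_trace_div ρ hσ.isHermitian h0 h1, ← sub_eq_add_neg]
    _ ≤ _ := sub_le_sub_right
        (trace_mul_cfc_tsallisLog_re_le hX (sub_ne_zero.2 h1) hδ hαδ) _

lemma neg_trace_opPow_mul_cfc_tsallisLog_re_le (hρ : ρ.PosSemidef) (hσ : σ.PosSemidef)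
    (h0 : 0 < α) (h1 : α ≠ 1) :
    -(opPow ρ α * cfc (tsallisLog ((1 - α) / α)) σ).trace.re ≤
      (sandwichedQ α ρ σ - (opPow ρ α).trace.re) / (α - 1) := by
  have hX := posSemidef_sandwich α ρ hσ
  have hklein := klein_inequality (f := fun x => (α - 1)⁻¹ * x ^ α)
    (g := fun x => α / (α - 1) * x ^ (α - 1)) hX.isHermitian hρ.isHermitian fun i j hij => by
      convert rpow_div_tangent_le (hX.eigenvalues_nonneg i) (hρ.eigenvalues_nonneg j)
        (eigenvalues_eq_zero_of_supp_le _ _ (supp_sandwich_le α hρ.isHermitian σ) hij) h0.le h1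
        using 1 <;> ring
  simp only [cfc_const_mul_rpow, Matrix.mul_smul,
    Matrix.sub_mul, mul_opPow_sub_one hρ h0.ne', Matrix.trace_smul, Matrix.trace_sub,
    trace_sandwich_mul_opPow hρ σ h0.ne', Complex.smul_re, Complex.sub_re, smul_eq_mul] at hklein
  have htsallis := trace_mul_opPow_sub_trace_div (opPow ρ α) hσ.isHermitian h0.ne' h1
  calc -(opPow ρ α * cfc (tsallisLog ((1 - α) / α)) σ).trace.re
      = α / (α - 1) * ((opPow ρ α * opPow σ ((1 - α) / α)).trace.re - (opPow ρ α).trace.re) := by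
        rw [div_mul_eq_mul_div, mul_div_assoc, htsallis, mul_neg, mul_inv_cancel_left₀ h0.ne']
    _ ≤ (α - 1)⁻¹ * (opPow (sandwich α ρ σ) α).trace.re - (α - 1)⁻¹ * (opPow ρ α).trace.re :=
        hklein
    _ = (sandwichedQ α ρ σ - (opPow ρ α).trace.re) / (α - 1) := by
        rw [sandwichedQ_eq α hρ hσ]; ring

lemma trace_opPow_mul_cfc_tsallisLog_re_le (hρ : ρ.PosSemidef) (hσ : σ.PosSemidef) (h0 : α ≠ 0)
    {s : ℝ} (hs : s ≠ 0) (hδ : δ ≠ 0) (hsδ : s ≤ δ) (h : s < 0 → supp ρ ≤ supp σ) :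
    (opPow ρ α * cfc (tsallisLog s) σ).trace.re ≤ (opPow ρ α * cfc (tsallisLog δ) σ).trace.re := by
  refine trace_cfc_mul_cfc_re_le hρ.isHermitian hσ.isHermitian fun i j hij => ?_
  have hρi := Real.rpow_nonneg (hρ.eigenvalues_nonneg i) α
  rcases hs.lt_or_gt with hs | hs
  · rcases (hσ.eigenvalues_nonneg j).eq_or_lt with hj | hj
    · have hi := eigenvalues_eq_zero_of_supp_le hρ.isHermitian hσ.isHermitian (h hs) hij hj.symm
      simp [hi, Real.zero_rpow h0]
    · exact mul_le_mul_of_nonneg_left (tsallisLog_le_tsallisLog hj hs.ne hδ hsδ) hρi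
  · exact mul_le_mul_of_nonneg_left
      (tsallisLog_le_tsallisLog_of_pos (hσ.eigenvalues_nonneg j) hs hsδ) hρi

lemma le_sandwichedTsallis (hρ : ρ.PosSemidef) (hσ : σ.PosSemidef) (h0 : 0 < α) (h1 : α ≠ 1)
    (hδ : δ ≠ 0) (hαδ : (1 - α) / α ≤ δ) (h : 1 < α → supp ρ ≤ supp σ) :
    (ρ * cfc (tsallisLog (α - 1)) ρ).trace.re - (opPow ρ α * cfc (tsallisLog δ) σ).trace.re ≤
      sandwichedTsallis α ρ σ := by
  have hmono := trace_opPow_mul_cfc_tsallisLog_re_le hρ hσ h0.ne'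
    (div_ne_zero (sub_ne_zero.2 h1.symm) h0.ne') hδ hαδ
    fun hs => h (by linarith [(div_lt_iff₀ h0).1 hs])
  have hklein := neg_trace_opPow_mul_cfc_tsallisLog_re_le hρ hσ h0 h1
  rw [← trace_opPow_sub_trace_div hρ h0.ne' h1]
  calc _ ≤ ((opPow ρ α).trace.re - ρ.trace.re) / (α - 1) +
        (sandwichedQ α ρ σ - (opPow ρ α).trace.re) / (α - 1) := by linarith
    _ = sandwichedTsallis α ρ σ := by rw [sandwichedTsallis]; ring

lemma tendsto_sandwichedTsallis_upper_bound (hρ : ρ.PosSemidef) (hσ : σ.PosSemidef)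
    (h : supp ρ ≤ supp σ) (hδ : 0 ≤ δ) :
    Tendsto (fun α => (sandwich α ρ σ * cfc (tsallisLog δ) (sandwich α ρ σ)).trace.re -
        α⁻¹ * (ρ * cfc (tsallisLog ((1 - α) / α)) σ).trace.re) (𝓝[≠] 1)
      (𝓝 (relEntropyWith (tsallisLog δ) Real.log ρ σ)) := by
  have hX := tendsto_sandwich hρ hσ h
  have hentropy := hX.mul (tendsto_cfc (continuous_tsallisLog hδ) hX
    (.of_forall fun α => (posSemidef_sandwich α ρ hσ).isHermitian) hρ.isHermitian)
  have hcross := (tendsto_mul_cfc_tsallisLog hσ h).comp tendsto_one_sub_div_nhdsNE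
  have hinv : Tendsto (fun α : ℝ => α⁻¹) (𝓝[≠] 1) (𝓝 1) := by
    simpa using (tendsto_inv₀ (one_ne_zero (α := ℝ))).mono_left nhdsWithin_le_nhds
  have hlim := ((continuous_trace_re.tendsto _).comp hentropy).sub
    (hinv.mul ((continuous_trace_re.tendsto _).comp hcross))
  rw [relEntropyWith, Matrix.mul_sub, Matrix.trace_sub, Complex.sub_re]
  simpa only [one_mul, Function.comp_def] using hlim

lemma tendsto_sandwichedTsallis_lower_bound (hρ : ρ.PosSemidef) (hσ : σ.IsHermitian) (hδ : 0 ≤ δ) :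
    Tendsto (fun p : ℝ × Matrix n n ℂ => (ρ * cfc (tsallisLog (p.1 - 1)) ρ).trace.re -
        (opPow ρ p.1 * cfc (tsallisLog δ) p.2).trace.re)
      (𝓝[≠] 1 ×ˢ 𝓝[{τ | τ.IsHermitian}] σ)
      (𝓝 (relEntropyWith Real.log (tsallisLog δ) ρ σ)) := by
  have hentropy := ((tendsto_mul_cfc_tsallisLog hρ le_rfl).comp tendsto_sub_one_nhdsNE).comp
    (tendsto_fst (g := 𝓝[{τ : Matrix n n ℂ | τ.IsHermitian}] σ))
  have hcross := (tendsto_opPow_one hρ).prodMap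
    (continuousOn_cfc_isHermitian (continuous_tsallisLog hδ) σ hσ)
  have hlim := ((continuous_trace_re.tendsto _).comp hentropy).sub
    ((continuous_trace_re.tendsto _).comp ((continuous_mul.tendsto _).comp
      (hcross.mono_right nhds_prod_eq.ge)))
  rw [relEntropyWith, Matrix.mul_sub, Matrix.trace_sub, Complex.sub_re]
  exact hlim

end SandwichedTsallisBounds

section Logarithm

variable {x s b : ℝ}

lemma elog_lt_coe_iff : elog x < b ↔ x < 2 ^ b := by
  unfold elog
  split_ifs with hx
  · simpa [EReal.bot_lt_coe] using hx.trans_lt (Real.rpow_pos_of_pos two_pos b)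
  · rw [EReal.coe_lt_coe_iff, Real.logb_lt_iff_lt_rpow one_lt_two (not_le.1 hx)]

lemma coe_lt_elog_iff : b < elog x ↔ 2 ^ b < x := by
  unfold elog
  split_ifs with hx
  · simpa using hx.trans (Real.rpow_pos_of_pos two_pos b).le
  · rw [EReal.coe_lt_coe_iff, Real.lt_logb_iff_rpow_lt one_lt_two (not_le.1 hx)]

lemma coe_one_div_mul_eq_div (s : ℝ) (y : EReal) : ((1 / s : ℝ) : EReal) * y = y / s := by
  rw [one_div, EReal.coe_inv, EReal.div_eq_inv_mul]

lemma coe_one_div_mul_eq_neg_div_neg (s : ℝ) (y : EReal) :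
    ((1 / s : ℝ) : EReal) * y = -(y / (-s : ℝ)) := by
  rw [← coe_one_div_mul_eq_div, ← EReal.neg_mul, ← EReal.coe_neg, ← one_div_neg_eq_neg_one_div,
    neg_neg]

lemma one_div_mul_elog_lt_coe_iff (hs : s ≠ 0) :
    ((1 / s : ℝ) : EReal) * elog x < b ↔ (x - 1) / s < tsallisLog s (2 ^ b) := by
  rw [tsallisLog, ← Real.rpow_mul two_pos.le]
  rcases hs.lt_or_gt with hs | hs
  · rw [div_lt_div_right_of_neg hs, sub_lt_sub_iff_right, ← coe_lt_elog_iff,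
      coe_one_div_mul_eq_neg_div_neg, EReal.neg_lt_comm, ← EReal.coe_neg,
      EReal.lt_div_iff (EReal.coe_pos.2 (neg_pos.2 hs)) (EReal.coe_ne_top _), ← EReal.coe_mul,
      neg_mul_neg]
  · rw [div_lt_div_iff_of_pos_right hs, sub_lt_sub_iff_right, ← elog_lt_coe_iff,
      coe_one_div_mul_eq_div, EReal.div_lt_iff (EReal.coe_pos.2 hs) (EReal.coe_ne_top _),
      EReal.coe_mul]

lemma coe_lt_one_div_mul_elog_iff (hs : s ≠ 0) :
    b < ((1 / s : ℝ) : EReal) * elog x ↔ tsallisLog s (2 ^ b) < (x - 1) / s := by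
  rw [tsallisLog, ← Real.rpow_mul two_pos.le]
  rcases hs.lt_or_gt with hs | hs
  · rw [div_lt_div_right_of_neg hs, sub_lt_sub_iff_right, ← elog_lt_coe_iff,
      coe_one_div_mul_eq_neg_div_neg, EReal.lt_neg_comm, ← EReal.coe_neg,
      EReal.div_lt_iff (EReal.coe_pos.2 (neg_pos.2 hs)) (EReal.coe_ne_top _), ← EReal.coe_mul,
      neg_mul_neg]
  · rw [div_lt_div_iff_of_pos_right hs, sub_lt_sub_iff_right, ← coe_lt_elog_iff,
      coe_one_div_mul_eq_div, EReal.lt_div_iff (EReal.coe_pos.2 hs) (EReal.coe_ne_top _),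
      EReal.coe_mul]

lemma tendsto_tsallisLog_two_rpow (b : ℝ) :
    Tendsto (fun α => tsallisLog (α - 1) (2 ^ b)) (𝓝[≠] 1) (𝓝 (b * Real.log 2)) := by
  rw [← Real.log_rpow two_pos]
  exact (tendsto_tsallisLog (Real.rpow_pos_of_pos two_pos b)).comp tendsto_sub_one_nhdsNE

end Logarithm

section SandwichedRelativeEntropy

variable {n : Type*} [Fintype n] [DecidableEq n] {ρ σ : Matrix n n ℂ} {α b : ℝ}

lemma sandwichedRelEntropy_lt_coe_iff (hρ : ρ.trace = 1) (h1 : α ≠ 1)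
    (h : 1 < α → supp ρ ≤ supp σ) :
    sandwichedRelEntropy α ρ σ < b ↔ sandwichedTsallis α ρ σ < tsallisLog (α - 1) (2 ^ b) := by
  have hcond := h1.lt_or_gt.imp_right fun hα => And.intro hα (h hα)
  rw [sandwichedRelEntropy, if_pos hcond, one_div_mul_elog_lt_coe_iff (sub_ne_zero.2 h1),
    sandwichedTsallis, hρ, Complex.one_re]

lemma coe_lt_sandwichedRelEntropy_iff (hρ : ρ.trace = 1) (h1 : α ≠ 1) :
    b < sandwichedRelEntropy α ρ σ ↔ ((1 < α → supp ρ ≤ supp σ) →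
      tsallisLog (α - 1) (2 ^ b) < sandwichedTsallis α ρ σ) := by
  by_cases h : 1 < α → supp ρ ≤ supp σ
  · have hcond := h1.lt_or_gt.imp_right fun hα => And.intro hα (h hα)
    rw [sandwichedRelEntropy, if_pos hcond, coe_lt_one_div_mul_elog_iff (sub_ne_zero.2 h1),
      sandwichedTsallis, hρ, Complex.one_re, imp_iff_right h]
  · obtain ⟨hα, hsupp⟩ := Classical.not_imp.1 h
    simp [sandwichedRelEntropy, hα.le.not_gt, hα, hsupp, EReal.coe_lt_top]

lemma limsup_sandwichedRelEntropy_le (hρ : IsState ρ) (hσ : σ.PosSemidef) :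
    limsup (fun α => sandwichedRelEntropy α ρ σ) (𝓝[≠] 1) ≤ relEntropy ρ σ := by
  refine (limsup_le_iff).2 fun y hy => ?_
  obtain ⟨b, hb, hby⟩ := EReal.lt_iff_exists_real_btwn.1 hy
  have h : supp ρ ≤ supp σ := by
    by_contra h
    simp [relEntropy, h] at hb
  obtain ⟨δ, hδ, hlt⟩ := exists_relEntropyWith_tsallisLog_left_lt hρ.1 h hb
  have hbound := tendsto_sandwichedTsallis_upper_bound hρ.1 hσ h hδ.le
  have hnear : ∀ᶠ α : ℝ in 𝓝[≠] 1, α - 1 < δ :=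
    (tendsto_nhds_of_tendsto_nhdsWithin tendsto_sub_one_nhdsNE).eventually_lt_const hδ
  filter_upwards [hbound.eventually_lt (tendsto_tsallisLog_two_rpow b) hlt, hnear,
    eventually_pos_and_ne_one] with α hα hαδ ⟨h0, h1⟩
  exact ((sandwichedRelEntropy_lt_coe_iff hρ.2 h1 fun _ => h).2
    ((sandwichedTsallis_le hρ.1 hσ h0.ne' h1 hδ.ne' hαδ.le).trans_lt hα)).trans hby

lemma relEntropy_le_liminf_sandwichedRelEntropy (hρ : IsState ρ) (hσ : σ.PosSemidef) :
    relEntropy ρ σ ≤ liminf (fun p : ℝ × Matrix n n ℂ => sandwichedRelEntropy p.1 ρ p.2)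
      (𝓝[≠] 1 ×ˢ 𝓝[{τ | τ.PosSemidef}] σ) := by
  refine (le_liminf_iff).2 fun y hy => ?_
  obtain ⟨b, hyb, hb⟩ := EReal.lt_iff_exists_real_btwn.1 hy
  obtain ⟨δ, hδ, hlt⟩ := exists_lt_relEntropyWith_tsallisLog_right hρ.1 hσ hb
  have hbound := (tendsto_sandwichedTsallis_lower_bound hρ.1 hσ.isHermitian hδ.le).mono_left
    (prod_mono_right _ (nhdsWithin_mono σ fun τ (hτ : τ.PosSemidef) => hτ.isHermitian))
  have hnear : ∀ᶠ α : ℝ in 𝓝[≠] 1, (1 - α) / α < δ :=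
    (tendsto_nhds_of_tendsto_nhdsWithin tendsto_one_sub_div_nhdsNE).eventually_lt_const hδ
  filter_upwards [((tendsto_tsallisLog_two_rpow b).comp tendsto_fst).eventually_lt hbound hlt,
    tendsto_fst.eventually hnear, tendsto_fst.eventually eventually_pos_and_ne_one,
    tendsto_snd.eventually self_mem_nhdsWithin] with p hp hpδ ⟨h0, h1⟩ hpsd
  exact hyb.trans ((coe_lt_sandwichedRelEntropy_iff hρ.2 h1).2 fun h =>
    hp.trans_le (le_sandwichedTsallis hρ.1 hpsd h0 h1 hδ.ne' hpδ.le h))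

end SandwichedRelativeEntropy

section Minimization

theorem tendsto_biInf_of_isCompact {ι X β : Type*} [TopologicalSpace X] [CompleteLinearOrder β]
    [DenselyOrdered β] [TopologicalSpace β] [OrderTopology β] {l : Filter ι} {K : Set X}
    (hK : IsCompact K) {F : ι → X → β} {f : X → β}
    (hliminf : ∀ x ∈ K, f x ≤ liminf (fun p : ι × X => F p.1 p.2) (l ×ˢ 𝓝[K] x))
    (hlimsup : ∀ x ∈ K, limsup (fun i => F i x) l ≤ f x) :
    Tendsto (fun i => ⨅ x ∈ K, F i x) l (𝓝 (⨅ x ∈ K, f x)) := by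
  refine tendsto_order.2 ⟨fun a ha => ?_, fun a ha => ?_⟩
  · obtain ⟨b, hab, hb⟩ := exists_between ha
    have huniform : ∀ᶠ i in l, ∀ x ∈ K, b < F i x := by
      refine hK.induction_on (p := fun S => ∀ᶠ i in l, ∀ x ∈ S, b < F i x) (by simp)
        (fun S T hST hT => hT.mono fun i hi x hx => hi x (hST hx))
        (fun S T hS hT => ?_) fun x hx => ?_
      · filter_upwards [hS, hT] with i hiS hiT x hx using hx.elim (hiS x) (hiT x)
      · have hbx : b < liminf (fun p : ι × X => F p.1 p.2) (l ×ˢ 𝓝[K] x) :=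
          (hb.trans_le (biInf_le f hx)).trans_le (hliminf x hx)
        obtain ⟨p, hp, q, hq, hpq⟩ := eventually_prod_iff.1 (eventually_lt_of_lt_liminf hbx)
        exact ⟨{y | q y}, hq, hp.mono fun i hi y hy => hpq hi hy⟩
    exact huniform.mono fun i hi => hab.trans_le (le_iInf₂ fun x hx => (hi x hx).le)
  · simp only [iInf_lt_iff, exists_prop] at ha
    obtain ⟨x, hx, hxa⟩ := ha
    exact (eventually_lt_of_limsup_lt ((hlimsup x hx).trans_lt hxa)).mono fun i hi =>
      (biInf_le (F i) hx).trans_lt hi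

end Minimization

section TraceNorm

variable {n : Type*}

lemma isClosed_setOf_posSemidef : IsClosed {A : Matrix n n ℂ | A.PosSemidef} := by
  simp only [Matrix.PosSemidef, Finsupp.sum, Set.ofPred_and, Set.ofPred_forall]
  exact (isClosed_eq (by fun_prop) continuous_id).inter
    (isClosed_iInter fun x => isClosed_le continuous_const (by fun_prop))

variable [Fintype n] {A : Matrix n n ℂ}

lemma norm_apply_le_trace (hA : A.PosSemidef) (i j : n) : ‖A i j‖ ≤ A.trace.re := by
  classical
  have hU := entry_norm_bound_of_unitary hA.isHermitian.eigenvectorUnitary.2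
  have hspectral := cfc_eq_conj hA.isHermitian fun x => x
  rw [cfc_id' ℝ A hA.isHermitian.isSelfAdjoint] at hspectral
  rw [trace_re_eq_sum_eigenvalues hA.isHermitian]
  nth_rw 1 [hspectral]
  rw [Matrix.mul_apply]
  refine norm_sum_le_of_le _ fun m _ => ?_
  rw [mul_diagonal, norm_mul, norm_mul, conjTranspose_apply, norm_star, Complex.norm_real,
    Real.norm_of_nonneg (hA.eigenvalues_nonneg m), mul_right_comm]
  exact mul_le_of_le_one_left (hA.eigenvalues_nonneg m)
    (mul_le_one₀ (hU i m) (norm_nonneg _) (hU j m))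

lemma isCompact_setOf_isState : IsCompact {ω : Matrix n n ℂ | IsState ω} := by
  have hbox : IsCompact (Set.univ.pi fun _ : n => Set.univ.pi fun _ : n =>
      Metric.closedBall (0 : ℂ) 1) :=
    isCompact_univ_pi fun _ => isCompact_univ_pi fun _ => isCompact_closedBall _ _
  refine hbox.of_isClosed_subset
    (isClosed_setOf_posSemidef.inter (isClosed_eq (by fun_prop) continuous_const)) ?_
  intro ω hω i _ j _
  have hentry := norm_apply_le_trace hω.1 i j
  rwa [hω.2, Complex.one_re, ← mem_closedBall_zero_iff] at hentry

variable [DecidableEq n]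

lemma continuous_traceNorm : Continuous fun A : Matrix n n ℂ => traceNorm A :=
  continuous_trace_re.comp ((continuousOn_cfc_isHermitian Real.continuous_sqrt).comp_continuous
    (by fun_prop) isHermitian_conjTranspose_mul_self)

lemma traceNorm_eq_trace_cfc_abs (hA : A.IsHermitian) :
    traceNorm A = (cfc (fun x : ℝ => |x|) A).trace.re := by
  have habs : (fun x : ℝ => |x|) = fun x => √(x * x) :=
    funext fun x => (Real.sqrt_mul_self_eq_abs x).symm
  rw [traceNorm, hA.eq, habs,
    cfc_comp' Real.sqrt (fun x => x * x) A Real.continuous_sqrt.continuousOn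
      (continuousOn_spectrum A _) hA.isSelfAdjoint,
    ← cfc_mul_cfc (fun x => x) (fun x => x), cfc_id' ℝ A hA.isSelfAdjoint]

lemma trace_le_traceNorm (hA : A.IsHermitian) : A.trace.re ≤ traceNorm A := by
  rw [traceNorm_eq_trace_cfc_abs hA, trace_cfc_re hA, trace_re_eq_sum_eigenvalues hA]
  exact Finset.sum_le_sum fun i _ => le_abs_self _

end TraceNorm

section RainsEntanglement

variable {k : ℕ} {d : Fin k → ℕ}

lemma isHermitian_partialTranspose (S : Finset (Fin k)) {X : Op d} (hX : X.IsHermitian) :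
    (partialTranspose S X).IsHermitian :=
  Matrix.IsHermitian.ext fun _ _ => hX.apply _ _

lemma trace_partialTranspose (S : Finset (Fin k)) (X : Op d) :
    (partialTranspose S X).trace = X.trace := by
  simp [partialTranspose, Matrix.trace]

lemma continuous_partialTranspose (S : Finset (Fin k)) :
    Continuous fun X : Op d => partialTranspose S X :=
  continuous_matrix fun _ _ => continuous_id.matrix_elem _ _

/-- The set of pairs of a probability distribution on the bipartitions and a family of states
indexed by them, over which the Rains entanglement is an infimum. -/
def feasibleSet (d : Fin k → ℕ) : Set ((Bipartition k → ℝ) × (Bipartition k → Op d)) :=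
  stdSimplex ℝ (Bipartition k) ×ˢ Set.univ.pi fun _ => {ω | IsState ω}

/-- The convex combination `∑ₘ rₘ ωₘ`. -/
def mixture (z : (Bipartition k → ℝ) × (Bipartition k → Op d)) : Op d :=
  ∑ m, (z.1 m : ℂ) • z.2 m

/-- The average trace norm `∑ₘ rₘ ‖Tₘ(ωₘ)‖₁` of the partial transposes. -/
def meanTraceNorm (z : (Bipartition k → ℝ) × (Bipartition k → Op d)) : ℝ :=
  ∑ m, z.1 m * traceNorm (partialTranspose m.1 (z.2 m))

lemma isCompact_feasibleSet : IsCompact (feasibleSet d) :=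
  (isCompact_stdSimplex ℝ _).prod (isCompact_univ_pi fun _ => isCompact_setOf_isState)

lemma continuous_mixture : Continuous (mixture (d := d)) := by
  unfold mixture; fun_prop

lemma continuous_meanTraceNorm : Continuous (meanTraceNorm (d := d)) :=
  continuous_finsetSum _ fun m _ => ((continuous_apply m).comp continuous_fst).mul
    (continuous_traceNorm.comp
      ((continuous_partialTranspose m.1).comp ((continuous_apply m).comp continuous_snd)))

variable {z : (Bipartition k → ℝ) × (Bipartition k → Op d)}

lemma isState_mixture (hz : z ∈ feasibleSet d) : IsState (mixture z) := by
  refine ⟨Matrix.posSemidef_sum _ fun m _ => (hz.2 m trivial).1.smul ?_, ?_⟩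
  · exact_mod_cast hz.1.1 m
  · simp only [mixture, Matrix.trace_sum, Matrix.trace_smul, (hz.2 _ trivial).2, smul_eq_mul,
      mul_one]
    exact_mod_cast hz.1.2

lemma one_le_meanTraceNorm (hz : z ∈ feasibleSet d) : 1 ≤ meanTraceNorm z := by
  rw [← hz.1.2, meanTraceNorm]
  refine Finset.sum_le_sum fun m _ => le_mul_of_one_le_right (hz.1.1 m) ?_
  have h := trace_le_traceNorm (isHermitian_partialTranspose m.1 (hz.2 m trivial).1.isHermitian)
  rwa [trace_partialTranspose, (hz.2 m trivial).2, Complex.one_re] at h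

lemma rainsEntanglement_eq_biInf (D : Op d → Op d → EReal) (ρ : Op d) :
    rainsEntanglement D ρ =
      ⨅ z ∈ feasibleSet d, (D ρ (mixture z) + (Real.logb 2 (meanTraceNorm z) : ℝ)) := by
  rw [← sInf_image, rainsEntanglement]
  congr 1
  ext x
  constructor
  · rintro ⟨σ, r, ω, -, hr, hr1, hω, rfl, rfl⟩
    exact ⟨(r, ω), ⟨⟨hr, hr1⟩, fun m _ => hω m⟩, rfl⟩
  · rintro ⟨z, hz, rfl⟩
    exact ⟨mixture z, z.1, z.2, isState_mixture hz, hz.1.1, hz.1.2, fun m => hz.2 m trivial,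
      rfl, rfl⟩

lemma tendsto_logb_meanTraceNorm (hz : z ∈ feasibleSet d) :
    Tendsto (fun w => ((Real.logb 2 (meanTraceNorm w) : ℝ) : EReal)) (𝓝[feasibleSet d] z)
      (𝓝 (Real.logb 2 (meanTraceNorm z) : ℝ)) := by
  have hne : meanTraceNorm z ≠ 0 := (zero_lt_one.trans_le (one_le_meanTraceNorm hz)).ne'
  exact (continuous_coe_real_ereal.tendsto _).comp
    (((continuous_meanTraceNorm.tendsto z).logb hne).mono_left nhdsWithin_le_nhds)

theorem tendsto_rainsEntanglement {ι : Type*} {l : Filter ι} [l.NeBot] {ρ : Op d}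
    {E : ι → Op d → Op d → EReal} {D : Op d → Op d → EReal}
    (hliminf : ∀ σ, IsState σ →
      D ρ σ ≤ liminf (fun p : ι × Op d => E p.1 ρ p.2) (l ×ˢ 𝓝[{τ | IsState τ}] σ))
    (hlimsup : ∀ σ, IsState σ → limsup (fun i => E i ρ σ) l ≤ D ρ σ) :
    Tendsto (fun i => rainsEntanglement (E i) ρ) l (𝓝 (rainsEntanglement D ρ)) := by
  simp only [rainsEntanglement_eq_biInf]
  refine tendsto_biInf_of_isCompact isCompact_feasibleSet (fun z hz => ?_) fun z hz => ?_
  · have := nhdsWithin_neBot_of_mem hz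
    have hmixture : Tendsto (Prod.map id mixture) (l ×ˢ 𝓝[feasibleSet d] z)
        (l ×ˢ 𝓝[{τ | IsState τ}] (mixture z)) :=
      tendsto_id.prodMap (continuous_mixture.continuousWithinAt.tendsto_nhdsWithin
        fun w hw => isState_mixture hw)
    have hnorm := (tendsto_logb_meanTraceNorm hz).comp (tendsto_snd (f := l))
    calc D ρ (mixture z) + (Real.logb 2 (meanTraceNorm z) : ℝ)
        ≤ liminf (fun p => E p.1 ρ (mixture p.2)) (l ×ˢ 𝓝[feasibleSet d] z) +
            liminf (fun p => ((Real.logb 2 (meanTraceNorm p.2) : ℝ) : EReal))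
              (l ×ˢ 𝓝[feasibleSet d] z) :=
          add_le_add ((hliminf _ (isState_mixture hz)).trans (liminf_le_liminf_of_le hmixture))
            hnorm.liminf_eq.ge
      _ ≤ _ := EReal.le_liminf_add
  · refine (EReal.limsup_add_le ?_ ?_).trans (add_le_add (hlimsup _ (isState_mixture hz)) ?_) <;>
      simp [limsup_const]

end RainsEntanglement

end MultipartiteRains

end

theorem mainTheorem9 (k : ℕ) (hk : 2 ≤ k) (d : Fin k → ℕ)
    (ρ : MultipartiteRains.Op d) (hρ : MultipartiteRains.IsState ρ) :
    Filter.Tendsto (fun α : ℝ => MultipartiteRains.sandwichedRains α ρ)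
      (nhdsWithin 1 {1}ᶜ) (nhds (MultipartiteRains.gmre ρ)) := by
  refine MultipartiteRains.tendsto_rainsEntanglement (fun σ hσ => ?_) fun σ hσ => ?_
  · exact (MultipartiteRains.relEntropy_le_liminf_sandwichedRelEntropy hρ hσ.1).trans
      (Filter.liminf_le_liminf_of_le
        (Filter.prod_mono_right _ (nhdsWithin_mono σ fun τ hτ => hτ.1)))
  · exact MultipartiteRains.limsup_sandwichedRelEntropy_le hρ hσ.1
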